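/- A flat Gauss diagram is an oriented circle carrying finitely many arrows with pairwise distinct endpoints, up to orientation-preserving homeomorphism; each arrow represents a flat crossing. A flat knot is an equivalence class of flat Gauss diagrams under the flat Reidemeister moves FR1, FR2, FR3. (In FR1 an isolated arrow, whose two endpoints are adjacent on the circle, is added or removed. In FR2 two arrows $x,y$ are added or removed whose endpoints form two pairs of adjacent points on the circle, the tail of $x$ with the head of $y$ and the head of $x$ with the tail of $y$, in any order. In FR3 the circle contains three disjoint arcs, in either cyclic order, on each of which two endpoints of three arrows $x,y,z$ are adjacent; writing $O_a,U_a$ for the tail and head of the arrow $a$, the arcs read either $U_zO_x,\ U_xO_y,\ U_yO_z$ or $O_zO_x,\ U_xU_y,\ U_zO_y$ along the orientation, and the move, or its inverse, exchanges the two endpoints on each of the three arcs.) The index $n(e)$ of an arrow $e$ is the number of arrow tails minus the number of arrow heads on the open interval of the circle that runs, in the direction of the orientation, from the tail of $e$ to the head of $e$. A flat Gauss diagram is almost classical if $n(e)=0$ for all of its arrows $e$, and a flat knot is almost classical if it is represented by some almost classical flat Gauss diagram. A flat Gauss diagram is of alternating pattern if, when the circle is traversed once from a suitable base point and $\mathtt{O}$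 is written for each arrow tail and $\mathtt{U}$ for each arrow head, the resulting word is $\mathtt{OUOU}\cdots\mathtt{OU}$ (possibly empty). **Lemma.** A flat knot is almost classical if and only if it is represented by some flat Gauss diagram (not necessarily with the minimal number of arrows) of alternating pattern. -/

import Mathlib

namespace FlatKnots

/-- The two kinds of endpoint of an arrow: `O` is the arrow tail, `U` is the arrow head. -/
inductive OU where
  | O
  | U
  deriving DecidableEq

/-- An endpoint of an arrow, with the name of the arrow. -/
abbrev Letter : Type := OU × ℕ

/-- The tail of arrow `n`. -/
abbrev O (n : ℕ) : Letter := (OU.O, n)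

/-- The head of arrow `n`. -/
abbrev U (n : ℕ) : Letter := (OU.U, n)

/-- A (one-component) flat Gauss diagram: an oriented circle carrying finitely many arrows with
distinct endpoints.  It is recorded by its Gauss code: the endpoints listed in the order in which
they are met when the circle is traversed once from a base point.  Each arrow has exactly one tail
and exactly one head. The empty word is the diagram without crossings. -/
structure GaussDiagram where
  word : List Letter
  nodup : word.Nodup
  paired : ∀ n : ℕ, O n ∈ word ↔ U n ∈ word

namespace GaussDiagram

/-- The open interval of the oriented circle from the tail of the arrow `e` to its head, as the
list of the arrow endpoints on it. The circle is first cut open at the tail of `e`. -/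
def arc (D : GaussDiagram) (e : ℕ) : List Letter :=
  ((D.word.rotate (D.word.idxOf (O e))).tail).takeWhile (fun x => decide (x ≠ U e))

/-- The index of the arrow `e`: the number of arrow tails minus the number of arrow heads on
the open interval from the tail of `e` to its head. -/
def index (D : GaussDiagram) (e : ℕ) : ℤ :=
  (((D.arc e).map Prod.fst).count OU.O : ℤ) - (((D.arc e).map Prod.fst).count OU.U : ℤ)

/-- A diagram is almost classical if all of its arrows have index zero. -/
def IsAlmostClassical (D : GaussDiagram) : Prop :=
  ∀ e : ℕ, O e ∈ D.word → D.index e = 0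

/-- The `OU`-word of the Gauss code: drop the names of the arrows. -/
def ouWord (D : GaussDiagram) : List OU := D.word.map Prod.fst

/-- Alternating pattern: the `OU`-word is `OUOU...OU`. -/
def IsAlternating (D : GaussDiagram) : Prop :=
  ∃ n : ℕ, D.ouWord = (List.replicate n [OU.O, OU.U]).flatten

end GaussDiagram

/-- The elementary modifications of Gauss codes: change of base point, change of the names of the
arrows, and the flat Reidemeister moves. It is only ever used between the codes of two
`GaussDiagram`s, so the arrows that a move introduces are automatically new and distinct. -/
inductive Move : List Letter → List Letter → Prop
  /-- The base point is moved. -/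
  | rotate (A B : List Letter) : Move (A ++ B) (B ++ A)
  /-- The arrows are renamed. -/
  | relabel (σ : Equiv.Perm ℕ) (A : List Letter) : Move A (A.map (Prod.map id σ))
  /-- First move: an isolated arrow is added, with the tail first or with the head first. -/
  | fr1_ou (x : ℕ) (A B : List Letter) : Move (A ++ B) (A ++ [O x, U x] ++ B)
  | fr1_uo (x : ℕ) (A B : List Letter) : Move (A ++ B) (A ++ [U x, O x] ++ B)
  /-- Second move, for two strands that run in the same direction along the bigon. The two new
  crossings have opposite intersection sign, so each strand gets one tail and one head. -/
  | fr2_parallel (x y : ℕ) (A B C : List Letter) :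
      Move (A ++ B ++ C) (A ++ [O x, U y] ++ B ++ [U x, O y] ++ C)
  /-- Second move, for two strands that run in opposite directions, with the bigon on the one
  side or on the other side of both of them. -/
  | fr2_antiparallel_ou (x y : ℕ) (A B C : List Letter) :
      Move (A ++ B ++ C) (A ++ [O x, U y] ++ B ++ [O y, U x] ++ C)
  | fr2_antiparallel_uo (x y : ℕ) (A B C : List Letter) :
      Move (A ++ B ++ C) (A ++ [U x, O y] ++ B ++ [U y, O x] ++ C)
  /-- Third move, for a triangle whose three sides are coherently oriented. A strand is moved across
  the crossing of the two others, so that on each strand the two crossings are exchanged. Two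
  constructors, for the two cyclic orders in which the knot can run through the three strands. -/
  | fr3_coherent (x y z : ℕ) (A B C D : List Letter) :
      Move (A ++ [U z, O x] ++ B ++ [U x, O y] ++ C ++ [U y, O z] ++ D)
        (A ++ [O x, U z] ++ B ++ [O y, U x] ++ C ++ [O z, U y] ++ D)
  | fr3_coherent' (x y z : ℕ) (A B C D : List Letter) :
      Move (A ++ [U z, O x] ++ B ++ [U y, O z] ++ C ++ [U x, O y] ++ D)
        (A ++ [O x, U z] ++ B ++ [O z, U y] ++ C ++ [O y, U x] ++ D)
  /-- Third move, for a triangle whose three sides are not coherently oriented; again for the two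
  cyclic orders of the three strands. -/
  | fr3_incoherent (x y z : ℕ) (A B C D : List Letter) :
      Move (A ++ [O z, O x] ++ B ++ [U x, U y] ++ C ++ [U z, O y] ++ D)
        (A ++ [O x, O z] ++ B ++ [U y, U x] ++ C ++ [O y, U z] ++ D)
  | fr3_incoherent' (x y z : ℕ) (A B C D : List Letter) :
      Move (A ++ [O z, O x] ++ B ++ [U z, O y] ++ C ++ [U x, U y] ++ D)
        (A ++ [O x, O z] ++ B ++ [O y, U z] ++ C ++ [U y, U x] ++ D)

/-- Two Gauss diagrams are equivalent (homotopic) if they are related by a finite sequence of moves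
and inverse moves. -/
def homotopySetoid : Setoid GaussDiagram :=
  Relation.EqvGen.setoid (fun D D' : GaussDiagram => Move D.word D'.word)

/-- A flat knot is a homotopy class of flat Gauss diagrams. -/
def FlatKnot : Type := Quotient homotopySetoid

/-- The Gauss diagram `D` represents the flat knot `α`. -/
def GaussDiagram.Represents (D : GaussDiagram) (α : FlatKnot) : Prop :=
  Quotient.mk homotopySetoid D = α

/-- A flat knot is almost classical if it has some almost classical diagram. -/
def FlatKnot.IsAlmostClassical (α : FlatKnot) : Prop :=
  ∃ D : GaussDiagram, D.Represents α ∧ D.IsAlmostClassical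

end FlatKnots

/-! An almost classical diagram is one that carries heights: going up by 1 at tails and down by 1 at
heads, both endpoints of each arrow `n` join the same two heights `ℓ n` and `ℓ n + 1`. This holds
because the arc from tail to head then starts and ends at `ℓ n + 1` (`isAlmostClassical_of_walk`,
`IsAlmostClassical.exists_walk`). When all levels coincide, the height oscillates between two
values, so the pattern alternates.

It remains to remove the highest level while there are at least two. Cyclically, a tail of a top
arrow `a` is followed by the head of a top arrow `b`, and `a ↦ b` permutes the top arrows. A fixed
point is removed by FR1 and a 2-cycle by FR2. A longer cycle `a, b, c, d, ...` (possibly `d = a`) is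
shortened to `a, y, d, ...` by FR2 followed by FR3, which sends `b`, `c` and a new arrow `x` one
level down (`exists_flip`, `exists_flip'`). -/

namespace FlatKnots

/-! ### Heights along a word. -/

/-- The change of height at an arrow endpoint: up at a tail, down at a head. -/
def weight (p : Letter) : ℤ := if p.1 = OU.O then 1 else -1

@[simp] theorem weight_O (n : ℕ) : weight (O n) = 1 := rfl

@[simp] theorem weight_U (n : ℕ) : weight (U n) = -1 := rfl

theorem eq_O_or_eq_U (p : Letter) : (∃ n, p = O n) ∨ ∃ n, p = U n := by
  rcases p with ⟨_ | _, n⟩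
  exacts [Or.inl ⟨n, rfl⟩, Or.inr ⟨n, rfl⟩]

/-- `Walk ℓ h w h'` says that reading `w` from height `h`, going up at tails and down at heads,
ends at height `h'`, and that each endpoint of an arrow `n` joins the heights `ℓ n` and `ℓ n + 1`. -/
def Walk (ℓ : ℕ → ℤ) : ℤ → List Letter → ℤ → Prop
  | h, [], h' => h = h'
  | h, (OU.O, n) :: w, h' => ℓ n = h ∧ Walk ℓ (h + 1) w h'
  | h, (OU.U, n) :: w, h' => ℓ n = h - 1 ∧ Walk ℓ (h - 1) w h'

@[simp] theorem walk_nil {ℓ : ℕ → ℤ} {h h' : ℤ} : Walk ℓ h [] h' ↔ h = h' := Iff.rfl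

@[simp] theorem walk_O_cons {ℓ : ℕ → ℤ} {h h' : ℤ} {n : ℕ} {w : List Letter} :
    Walk ℓ h (O n :: w) h' ↔ ℓ n = h ∧ Walk ℓ (h + 1) w h' := Iff.rfl

@[simp] theorem walk_U_cons {ℓ : ℕ → ℤ} {h h' : ℤ} {n : ℕ} {w : List Letter} :
    Walk ℓ h (U n :: w) h' ↔ ℓ n = h - 1 ∧ Walk ℓ (h - 1) w h' := Iff.rfl

theorem walk_append {ℓ : ℕ → ℤ} {A B : List Letter} {h h' : ℤ} :
    Walk ℓ h (A ++ B) h' ↔ ∃ k, Walk ℓ h A k ∧ Walk ℓ k B h' := by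
  induction A generalizing h with
  | nil => simp
  | cons p A ih =>
    rcases eq_O_or_eq_U p with ⟨n, rfl⟩ | ⟨n, rfl⟩ <;> simp [ih, and_assoc]

theorem Walk.end_eq {ℓ : ℕ → ℤ} {w : List Letter} {h h' : ℤ} (hw : Walk ℓ h w h') :
    h' = h + (w.map weight).sum := by
  induction w generalizing h with
  | nil => simpa using hw.symm
  | cons p w ih =>
    rcases eq_O_or_eq_U p with ⟨n, rfl⟩ | ⟨n, rfl⟩
    · simp only [walk_O_cons] at hw
      simp [ih hw.2]; ring
    · simp only [walk_U_cons] at hw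
      simp [ih hw.2]; ring

theorem Walk.congr {ℓ ℓ' : ℕ → ℤ} {w : List Letter} {h h' : ℤ} (hw : Walk ℓ h w h')
    (hl : ∀ p ∈ w, ℓ' p.2 = ℓ p.2) : Walk ℓ' h w h' := by
  induction w generalizing h with
  | nil => exact hw
  | cons p w ih =>
    have h1 := hl p (by simp)
    have h2 : ∀ q ∈ w, ℓ' q.2 = ℓ q.2 := fun q hq => hl q (by simp [hq])
    rcases eq_O_or_eq_U p with ⟨n, rfl⟩ | ⟨n, rfl⟩
    · exact ⟨h1.trans hw.1, ih hw.2 h2⟩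
    · exact ⟨h1.trans hw.1, ih hw.2 h2⟩

/-- Turns conditions on prefix sums, the form in which levels are first defined, into the recursive
form of `Walk`. -/
theorem walk_of_split {ℓ : ℕ → ℤ} {w : List Letter} {h : ℤ}
    (hO : ∀ A n B, w = A ++ O n :: B → ℓ n = h + (A.map weight).sum)
    (hU : ∀ A n B, w = A ++ U n :: B → ℓ n = h + (A.map weight).sum - 1) :
    Walk ℓ h w (h + (w.map weight).sum) := by
  induction w generalizing h with
  | nil => simp
  | cons p w ih =>
    rcases eq_O_or_eq_U p with ⟨n, rfl⟩ | ⟨n, rfl⟩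
    · have := ih (h := h + 1)
        (fun A m B e => by have := hO (O n :: A) m B (by simp [e]); simp at this; linarith)
        (fun A m B e => by have := hU (O n :: A) m B (by simp [e]); simp at this; linarith)
      refine ⟨by simpa using hO [] n w rfl, ?_⟩
      convert this using 1
      simp; ring
    · have := ih (h := h - 1)
        (fun A m B e => by have := hO (U n :: A) m B (by simp [e]); simp at this; linarith)
        (fun A m B e => by have := hU (U n :: A) m B (by simp [e]); simp at this; linarith)
      refine ⟨by simpa using hU [] n w rfl, ?_⟩
      convert this using 1
      simp; ring

theorem count_sub_count_eq_sum_weight (w : List Letter) :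
    (((w.map Prod.fst).count OU.O : ℤ) - ((w.map Prod.fst).count OU.U : ℤ))
      = (w.map weight).sum := by
  induction w with
  | nil => simp
  | cons p w ih =>
    rcases eq_O_or_eq_U p with ⟨n, rfl⟩ | ⟨n, rfl⟩
    · simp [← ih]; ring
    · simp [← ih]; ring

/-! ### Gauss codes and total weight. -/

/-- The words that are Gauss codes. -/
def IsCode (w : List Letter) : Prop := w.Nodup ∧ ∀ n : ℕ, O n ∈ w ↔ U n ∈ w

/-- Validity of a code depends only on its multiset of letters, so the words produced by moves can
be checked by counting letters. -/
theorem IsCode.perm {w w' : List Letter} (hw : IsCode w) (p : w.Perm w') : IsCode w' :=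
  ⟨p.nodup_iff.1 hw.1, fun n => by rw [← p.mem_iff, ← p.mem_iff]; exact hw.2 n⟩

theorem isCode_cons_cons {x : ℕ} {w : List Letter} :
    IsCode (O x :: U x :: w) ↔ IsCode w ∧ O x ∉ w ∧ U x ∉ w := by
  constructor
  · rintro ⟨h1, h2⟩
    simp only [List.nodup_cons, List.mem_cons, not_or] at h1
    refine ⟨⟨h1.2.2, fun n => ?_⟩, h1.1.2, h1.2.1⟩
    have := h2 n
    by_cases hn : n = x
    · subst hn; simp [h1.1.2, h1.2.1]
    · simpa [hn] using this
  · rintro ⟨⟨h1, h2⟩, h3, h4⟩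
    refine ⟨by simp [h1, h3, h4], fun n => ?_⟩
    simp [h2 n]

namespace GaussDiagram

theorem isCode (D : GaussDiagram) : IsCode D.word := ⟨D.nodup, D.paired⟩

theorem mk_eq_mk {D D' : GaussDiagram} (h : Move D.word D'.word) :
    Quotient.mk homotopySetoid D = Quotient.mk homotopySetoid D' :=
  Quotient.sound (Relation.EqvGen.rel _ _ h)

/-- Exchanging the tail and the head of every arrow permutes the letters and negates the weights. -/
theorem sum_weight (D : GaussDiagram) : (D.word.map weight).sum = 0 := by
  let s : Letter → Letter := fun p => (if p.1 = OU.O then OU.U else OU.O, p.2)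
  have hs : Function.Involutive s := by rintro ⟨_ | _, n⟩ <;> rfl
  have hp : (D.word.map s).Perm D.word := by
    rw [List.perm_ext_iff_of_nodup (D.nodup.map hs.injective) D.nodup]
    intro p
    rw [List.mem_map]
    constructor
    · rintro ⟨⟨_ | _, n⟩, hq, rfl⟩
      exacts [(D.paired n).1 hq, (D.paired n).2 hq]
    · intro hq
      refine ⟨s p, ?_, hs p⟩
      rcases p with ⟨_ | _, n⟩
      exacts [(D.paired n).1 hq, (D.paired n).2 hq]
  have h1 := (hp.map weight).sum_eq
  have h2 : ∀ w : List Letter, ((w.map s).map weight).sum = - (w.map weight).sum := by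
    intro w
    induction w with
    | nil => rfl
    | cons p w ih =>
      rcases p with ⟨_ | _, n⟩ <;> simp_all [s, weight] <;> ring
  rw [h2] at h1
  linarith

/-! ### The index as a height difference. -/

theorem arc_eq_takeWhile {D : GaussDiagram} {e : ℕ} {A B : List Letter}
    (h : D.word = A ++ O e :: B) :
    D.arc e = (B ++ A).takeWhile (fun x => decide (x ≠ U e)) := by
  have hA : O e ∉ A := by
    have := D.nodup
    rw [h] at this
    grind
  have hi : (A ++ O e :: B).idxOf (O e) = A.length := by
    rw [List.idxOf_append_of_notMem hA]; simp
  rw [arc, h, hi, List.rotate_append_length_eq]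
  rfl

theorem takeWhile_ne_append {e : ℕ} {A B : List Letter} (h : U e ∉ A) :
    (A ++ U e :: B).takeWhile (fun x => decide (x ≠ U e)) = A := by
  rw [List.takeWhile_append_of_pos]
  · simp
  · intro x hx
    simp only [decide_eq_true_eq]
    rintro rfl
    exact h hx

theorem index_of_tail_first {D : GaussDiagram} {e : ℕ} {A B C : List Letter}
    (h : D.word = A ++ O e :: (B ++ U e :: C)) : D.index e = (B.map weight).sum := by
  have hB : U e ∉ B := by
    have := D.nodup
    rw [h] at this
    grind
  rw [index, count_sub_count_eq_sum_weight, arc_eq_takeWhile h, List.append_assoc,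
    List.cons_append, takeWhile_ne_append hB]

theorem index_of_head_first {D : GaussDiagram} {e : ℕ} {A B C : List Letter}
    (h : D.word = A ++ U e :: (B ++ O e :: C)) :
    D.index e = (C.map weight).sum + (A.map weight).sum := by
  have hB : U e ∉ C ++ A := by
    have := D.nodup
    rw [h] at this
    grind
  have h' : D.word = (A ++ U e :: B) ++ O e :: C := by simp [h]
  rw [index, count_sub_count_eq_sum_weight, arc_eq_takeWhile h', ← List.append_assoc,
    takeWhile_ne_append hB]
  simp

/-- The endpoints of an arrow cut the word in one of two ways. -/
theorem exists_split {D : GaussDiagram} {e : ℕ} (he : O e ∈ D.word) :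
    (∃ A B C, D.word = A ++ O e :: (B ++ U e :: C)) ∨
      ∃ A B C, D.word = A ++ U e :: (B ++ O e :: C) := by
  have hU := (D.paired e).1 he
  obtain ⟨A, B, h⟩ := List.append_of_mem he
  rw [h] at hU
  simp only [List.mem_append, List.mem_cons, Prod.mk.injEq, reduceCtorEq, false_and,
    false_or] at hU
  rcases hU with hU | hU
  · obtain ⟨A1, A2, rfl⟩ := List.append_of_mem hU
    exact Or.inr ⟨A1, A2, B, by simp [h]⟩
  · obtain ⟨B1, B2, rfl⟩ := List.append_of_mem hU
    exact Or.inl ⟨A, B1, B2, h⟩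

/-- The arc of `e` begins and ends at height `ℓ e + 1`. If it passes the base point, closedness of
the walk joins its two pieces. -/
theorem isAlmostClassical_of_walk {D : GaussDiagram} {ℓ : ℕ → ℤ} {h : ℤ}
    (hw : Walk ℓ h D.word h) : D.IsAlmostClassical := by
  intro e he
  rcases exists_split he with ⟨A, B, C, hs⟩ | ⟨A, B, C, hs⟩
  · rw [index_of_tail_first hs]
    rw [hs, walk_append] at hw
    obtain ⟨k, -, hk, hw⟩ := hw
    obtain ⟨k', hB, hk', -⟩ := walk_append.1 hw
    have := hB.end_eq
    linarith
  · rw [index_of_head_first hs]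
    rw [hs, walk_append] at hw
    obtain ⟨k, hA, hk, hw⟩ := hw
    obtain ⟨k', -, hk', hC⟩ := walk_append.1 hw
    have h1 := hA.end_eq
    have h2 := hC.end_eq
    linarith

theorem eq_of_append_cons_eq {w A A' B B' : List Letter} {p : Letter} (hw : w.Nodup)
    (h : w = A ++ p :: B) (h' : w = A' ++ p :: B') : A = A' := by
  have key : ∀ {A B : List Letter}, w = A ++ p :: B → w.take (w.idxOf p) = A := by
    rintro A B rfl
    have hA : p ∉ A := by grind
    rw [List.idxOf_append_of_notMem hA]
    simp
  exact (key h).symm.trans (key h')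

/-- The level of an arrow is the height just before its tail. Index zero makes the head agree; when
the head comes first, the total weight zero is also needed. -/
theorem IsAlmostClassical.exists_walk {D : GaussDiagram} (hD : D.IsAlmostClassical) :
    ∃ ℓ, Walk ℓ 0 D.word 0 := by
  let ℓ : ℕ → ℤ := fun n => ((D.word.take (D.word.idxOf (O n))).map weight).sum
  have hℓ : ∀ A n B, D.word = A ++ O n :: B → ℓ n = (A.map weight).sum := by
    intro A n B h
    have hA : O n ∉ A := by
      have := D.nodup
      rw [h] at this
      grind
    simp only [ℓ]
    rw [h, List.idxOf_append_of_notMem hA]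
    simp
  refine ⟨ℓ, ?_⟩
  have hs := D.sum_weight
  have := walk_of_split (ℓ := ℓ) (w := D.word) (h := 0)
    (fun A n B h => by rw [hℓ A n B h]; ring) ?_
  · rwa [hs] at this
  intro A n B h
  have hn : O n ∈ D.word := (D.paired n).2 (by simp [h])
  have h0 := hD n hn
  rcases exists_split hn with ⟨A', B', C', h'⟩ | ⟨A', B', C', h'⟩
  · rw [index_of_tail_first h'] at h0
    obtain rfl := eq_of_append_cons_eq D.nodup h
      (show D.word = (A' ++ O n :: B') ++ U n :: C' by simp [h'])
    rw [hℓ _ _ _ h']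
    simp [h0]
  · rw [index_of_head_first h'] at h0
    obtain rfl := eq_of_append_cons_eq D.nodup h h'
    rw [hℓ (A ++ U n :: B') n C' (by simp [h'])]
    rw [h'] at hs
    simp at hs ⊢
    linarith

theorem IsAlternating.exists_walk {D : GaussDiagram} (hD : D.IsAlternating) :
    ∃ ℓ, Walk ℓ 0 D.word 0 := by
  obtain ⟨n, hn⟩ := hD
  refine ⟨fun _ => 0, ?_⟩
  rw [ouWord] at hn
  generalize D.word = w at hn
  induction n generalizing w with
  | zero => simp at hn; simp [hn]
  | succ n ih =>
    rw [List.replicate_succ] at hn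
    rcases w with _ | ⟨⟨_ | _, a⟩, _ | ⟨⟨_ | _, b⟩, w⟩⟩ <;> simp at hn
    refine ⟨rfl, by norm_num, ?_⟩
    have := ih w (by simpa using hn)
    simpa using this

end GaussDiagram

/-! ### Levelings, peaks and changes of level. -/

theorem alternating_of_walk {ℓ : ℕ → ℤ} {m : ℤ} : ∀ {w : List Letter},
    (∀ p ∈ w, ℓ p.2 = m) → Walk ℓ m w m →
      ∃ n : ℕ, w.map Prod.fst = (List.replicate n [OU.O, OU.U]).flatten
  | [], _, _ => ⟨0, rfl⟩
  | (OU.U, a) :: w, hm, hw => by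
    have h1 := hm (U a) (by simp)
    have h2 := hw.1
    simp only at h1
    omega
  | [(OU.O, a)], hm, hw => by
    have h2 := hw.2
    simp at h2
  | (OU.O, a) :: (OU.O, b) :: w, hm, hw => by
    have h1 := hm (O b) (by simp)
    have h2 := hw.2.1
    simp only at h1
    omega
  | (OU.O, a) :: (OU.U, b) :: w, hm, hw => by
    have h2 := hw.2.2
    rw [add_sub_cancel_right] at h2
    obtain ⟨n, hn⟩ := alternating_of_walk (fun p hp => hm p (by simp [hp])) h2
    exact ⟨n + 1, by simp [List.replicate_succ, hn]⟩

/-- A closed walk that only uses arrows with levels between `lo` and `hi`. -/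
def IsLeveling (ℓ : ℕ → ℤ) (lo hi : ℤ) (w : List Letter) : Prop :=
  (∃ h, Walk ℓ h w h) ∧ ∀ p ∈ w, lo ≤ ℓ p.2 ∧ ℓ p.2 ≤ hi

theorem IsLeveling.rotate {ℓ : ℕ → ℤ} {lo hi : ℤ} {A B : List Letter}
    (h : IsLeveling ℓ lo hi (A ++ B)) : IsLeveling ℓ lo hi (B ++ A) := by
  obtain ⟨⟨h, hw⟩, hb⟩ := h
  obtain ⟨k, h1, h2⟩ := walk_append.1 hw
  exact ⟨⟨k, walk_append.2 ⟨h, h2, h1⟩⟩, fun p hp => hb p (by simp at hp ⊢; tauto)⟩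

/-- The number of endpoints of arrows of level `t`. -/
def levelCount (ℓ : ℕ → ℤ) (t : ℤ) (w : List Letter) : ℕ :=
  w.countP (fun p => decide (ℓ p.2 = t))

/-- The base point can be moved to any tail. -/
theorem exists_rotate_to_tail (D : GaussDiagram) {a : ℕ} (ha : O a ∈ D.word) :
    ∃ (D' : GaussDiagram) (A B : List Letter), D.word = A ++ O a :: B ∧
      D'.word = O a :: B ++ A ∧
      Quotient.mk homotopySetoid D = Quotient.mk homotopySetoid D' := by
  obtain ⟨A, B, h⟩ := List.append_of_mem ha
  have hc : IsCode (O a :: B ++ A) := D.isCode.perm (by rw [h]; exact List.perm_append_comm)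
  refine ⟨⟨_, hc.1, hc.2⟩, A, B, h, rfl, GaussDiagram.mk_eq_mk ?_⟩
  simp only [h]
  exact Move.rotate A (O a :: B)

/-- A tail of an arrow of the highest level is followed by a head. -/
theorem exists_peak {ℓ : ℕ → ℤ} {lo hi h : ℤ} {A B : List Letter} {a : ℕ}
    (hw : Walk ℓ h (A ++ O a :: B) h) (hb : ∀ p ∈ A ++ O a :: B, lo ≤ ℓ p.2 ∧ ℓ p.2 ≤ hi)
    (ha : ℓ a = hi) (hh : h ≤ hi) : ∃ b C, B = U b :: C ∧ ℓ b = hi := by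
  obtain ⟨k, -, hk, h2⟩ := walk_append.1 hw
  rcases B with _ | ⟨p, C⟩
  -- A word ending at this tail would end at height `hi + 1`, above its starting height.
  · simp at h2; omega
  · rcases eq_O_or_eq_U p with ⟨b, rfl⟩ | ⟨b, rfl⟩
    · have := (hb (O b) (by simp)).2
      have h3 := h2.1
      simp only at this
      omega
    · exact ⟨b, C, rfl, by have := h2.1; omega⟩

theorem exists_fresh (w : List Letter) :
    ∃ x y : ℕ, x ≠ y ∧ ∀ p ∈ w, p.2 ≠ x ∧ p.2 ≠ y := by
  obtain ⟨x, hx⟩ := Infinite.exists_notMem_finset (w.map Prod.snd).toFinset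
  obtain ⟨y, hy⟩ := Infinite.exists_notMem_finset (insert x (w.map Prod.snd).toFinset)
  simp only [Finset.mem_insert, List.mem_toFinset, List.mem_map, not_or, not_exists] at hx hy
  refine ⟨x, y, fun h => hy.1 h.symm, fun p hp => ⟨fun h => hx p ⟨hp, h⟩, fun h => hy.2 p ⟨hp, h⟩⟩⟩

theorem IsCode.insert_two {x y : ℕ} {w w' : List Letter} (hw : IsCode w) (hxy : x ≠ y)
    (hf : ∀ p ∈ w, p.2 ≠ x ∧ p.2 ≠ y)
    (hp : (O x :: U x :: O y :: U y :: w).Perm w') : IsCode w' := by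
  have hx : ∀ s : OU, (s, x) ∉ w := fun s h => (hf _ h).1 rfl
  have hy : ∀ s : OU, (s, y) ∉ w := fun s h => (hf _ h).2 rfl
  refine IsCode.perm ?_ hp
  rw [isCode_cons_cons, isCode_cons_cons]
  simp [hw, hx, hy, hxy]

theorem levelCount_congr {ℓ ℓ' : ℕ → ℤ} {t : ℤ} {w : List Letter}
    (h : ∀ p ∈ w, ℓ' p.2 = ℓ p.2) : levelCount ℓ' t w = levelCount ℓ t w := by
  unfold levelCount
  exact List.countP_congr fun p hp => by simp [h p hp]

theorem snd_ne_of_notMem {w : List Letter} {b : ℕ} (hw : O b ∉ w ∧ U b ∉ w) :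
    ∀ p ∈ w, p.2 ≠ b := by
  rintro ⟨_ | _, n⟩ hp rfl
  exacts [hw.1 hp, hw.2 hp]

/-- New levels after two arrows `b`, `c` of the highest level have been pushed down, and
new arrows `x`, `y` have been added on the second highest and the highest level. -/
theorem exists_levels {ℓ : ℕ → ℤ} {lo t : ℤ} {x y b c : ℕ} {w r : List Letter}
    (hlt : lo < t) (hcode : IsCode w) (hxy : x ≠ y) (hf : ∀ p ∈ w, p.2 ≠ x ∧ p.2 ≠ y)
    (hr : w.Perm (O b :: U b :: O c :: U c :: r)) (hbd : ∀ p ∈ w, lo ≤ ℓ p.2 ∧ ℓ p.2 ≤ t)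
    (hb : ℓ b = t) (hc : ℓ c = t) :
    ∃ ℓ' : ℕ → ℤ, (∀ p ∈ r, ℓ' p.2 = ℓ p.2) ∧ ℓ' x = t - 1 ∧ ℓ' b = t - 1 ∧ ℓ' c = t - 1 ∧
      ℓ' y = t ∧ ∀ w' : List Letter, (O x :: U x :: O y :: U y :: w).Perm w' →
        (∀ p ∈ w', lo ≤ ℓ' p.2 ∧ ℓ' p.2 ≤ t) ∧ levelCount ℓ' t w' < levelCount ℓ t w := by
  have h1 := hcode.perm hr
  rw [isCode_cons_cons, isCode_cons_cons] at h1
  obtain ⟨⟨-, hc'⟩, hb'⟩ := h1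
  have hcr := snd_ne_of_notMem hc'
  have hbr := snd_ne_of_notMem hb'
  have hfr : ∀ p ∈ r, p.2 ≠ x ∧ p.2 ≠ y := fun p hp => hf p (hr.mem_iff.2 (by simp [hp]))
  have hyb := (hf (O b) (hr.mem_iff.2 (by simp))).2
  have hyc := (hf (O c) (hr.mem_iff.2 (by simp))).2
  let ℓ' : ℕ → ℤ := fun n => if n = x ∨ n = b ∨ n = c then t - 1 else if n = y then t else ℓ n
  have er : ∀ p ∈ r, ℓ' p.2 = ℓ p.2 := fun p hp => by
    simp [ℓ', (hfr p hp).1, (hfr p hp).2, hcr p hp, hbr p (by simp [hp])]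
  have ex : ℓ' x = t - 1 := by simp [ℓ']
  have eb : ℓ' b = t - 1 := by simp [ℓ']
  have ec : ℓ' c = t - 1 := by simp [ℓ']
  have ey : ℓ' y = t := by simp [ℓ', hxy.symm, Ne.symm hyb, Ne.symm hyc]
  refine ⟨ℓ', er, ex, eb, ec, ey, fun w' hw' => ?_⟩
  clear_value ℓ'
  have hp : w'.Perm (O x :: U x :: O y :: U y :: O b :: U b :: O c :: U c :: r) :=
    hw'.symm.trans (((((hr.cons _).cons _).cons _).cons _))
  constructor
  · intro p hpw
    rw [hp.mem_iff] at hpw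
    simp only [List.mem_cons] at hpw
    rcases hpw with rfl | rfl | rfl | rfl | rfl | rfl | rfl | rfl | hpr
    any_goals constructor <;> simp only <;> linarith
    rw [er p hpr]
    exact hbd p (hr.mem_iff.2 (by simp [hpr]))
  -- Level `t` loses the four endpoints of `b` and `c` and gains the two of `y`.
  · have cr := levelCount_congr (t := t) er
    unfold levelCount at *
    rw [hp.countP_eq, hr.countP_eq]
    simp [cr, ex, eb, ec, ey, hb, hc]

/-! ### Shortening cycles of peaks. -/

/-- A cycle of at least three peaks `a b`, `b c`, `c d`, ... can be shortened: first case. -/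
theorem exists_flip {D : GaussDiagram} {ℓ : ℕ → ℤ} {lo t : ℤ} {a b c d : ℕ}
    {B C E : List Letter} (hlt : lo < t) (hL : IsLeveling ℓ lo t D.word)
    (hw : Walk ℓ t D.word t)
    (h : D.word = O a :: U b :: (B ++ O b :: U c :: (C ++ O c :: U d :: E))) :
    ∃ (D' : GaussDiagram) (ℓ' : ℕ → ℤ),
      Quotient.mk homotopySetoid D = Quotient.mk homotopySetoid D' ∧
      IsLeveling ℓ' lo t D'.word ∧ levelCount ℓ' t D'.word < levelCount ℓ t D.word := by
  obtain ⟨x, y, hxy, hf⟩ := exists_fresh D.word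
  have hcode := D.isCode
  -- FR2 gives `W1`, in which `O x U b`, `O b U c`, `O c U x` are the three sides of a coherent
  -- triangle. FR3 turns these peaks into the valleys `U b O x`, `U c O b`, `U x O c` of `W2`,
  -- leaving `O a U y` and `O y U d` as peaks.
  let W1 := [O a] ++ [U y, O x] ++ (U b :: B ++ O b :: U c :: C ++ [O c]) ++ [U x, O y]
    ++ (U d :: E)
  let W2 := [O a, U y] ++ [U b, O x] ++ B ++ [U c, O b] ++ C ++ [U x, O c] ++ (O y :: U d :: E)
  have p1 : (O x :: U x :: O y :: U y :: D.word).Perm W1 := by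
    rw [h, List.perm_iff_count]; intro p
    simp only [W1, List.count_append, List.count_cons, List.count_nil]; omega
  have p2 : W1.Perm W2 := by
    rw [List.perm_iff_count]; intro p
    simp only [W1, W2, List.count_append, List.count_cons, List.count_nil]; omega
  have hr : D.word.Perm (O b :: U b :: O c :: U c :: (O a :: U d :: (B ++ C ++ E))) := by
    rw [h, List.perm_iff_count]; intro p
    simp only [List.count_append, List.count_cons]; omega
  have hc1 : IsCode W1 := hcode.insert_two hxy hf p1
  have hc2 : IsCode W2 := hc1.perm p2
  have e1 : Quotient.mk homotopySetoid D = Quotient.mk homotopySetoid ⟨W1, hc1.1, hc1.2⟩ := by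
    apply GaussDiagram.mk_eq_mk
    have := Move.fr2_antiparallel_uo y x [O a] (U b :: B ++ O b :: U c :: C ++ [O c]) (U d :: E)
    simpa [W1, h] using this
  have e2 : Quotient.mk homotopySetoid ⟨W2, hc2.1, hc2.2⟩ =
      Quotient.mk homotopySetoid ⟨W1, hc1.1, hc1.2⟩ := by
    apply GaussDiagram.mk_eq_mk
    have := Move.fr3_coherent' x c b [O a, U y] B C (O y :: U d :: E)
    simpa [W1, W2] using this
  rw [h] at hw
  obtain ⟨w1, w2, hw⟩ := hw
  obtain ⟨k, wB, w3, w4, hw⟩ := walk_append.1 hw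
  obtain ⟨k', wC, w5, w6, wE⟩ := walk_append.1 hw
  rw [add_sub_cancel_right] at wB w4 wC w2 wE w6
  obtain rfl : k = t := by linarith
  obtain rfl : k' = k := by linarith
  obtain ⟨ℓ', er, ex, eb, ec, ey, hw'⟩ := exists_levels hlt hcode hxy hf hr hL.2 w2 w4
  obtain ⟨hbd, hcount⟩ := hw' W2 (p1.trans p2)
  refine ⟨⟨W2, hc2.1, hc2.2⟩, ℓ', e1.trans e2.symm, ⟨⟨k', ?_⟩, hbd⟩, hcount⟩
  have ea := er (O a) (by simp)
  have ed := er (U d) (by simp)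
  simp only at ea ed
  simp only [W2, walk_append, walk_O_cons, walk_U_cons, List.cons_append, List.nil_append,
    List.append_assoc]
  refine ⟨by linarith, by linarith, by linarith, by linarith, k', ?_, by linarith, by linarith,
    k', ?_, by linarith, by linarith, by linarith, by linarith, ?_⟩
  · convert wB.congr fun p hp => er p (by simp [hp]) using 1; ring
  · convert wC.congr fun p hp => er p (by simp [hp]) using 1; ring
  · convert wE.congr fun p hp => er p (by simp [hp]) using 1; ring

/-- A cycle of at least three peaks `a b`, `b c`, `c d`, ... can be shortened: second case. -/
theorem exists_flip' {D : GaussDiagram} {ℓ : ℕ → ℤ} {lo t : ℤ} {a b c d : ℕ}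
    {B C E : List Letter} (hlt : lo < t) (hL : IsLeveling ℓ lo t D.word)
    (hw : Walk ℓ t D.word t)
    (h : D.word = O a :: U b :: (B ++ O c :: U d :: (C ++ O b :: U c :: E))) :
    ∃ (D' : GaussDiagram) (ℓ' : ℕ → ℤ),
      Quotient.mk homotopySetoid D = Quotient.mk homotopySetoid D' ∧
      IsLeveling ℓ' lo t D'.word ∧ levelCount ℓ' t D'.word < levelCount ℓ t D.word := by
  obtain ⟨x, y, hxy, hf⟩ := exists_fresh D.word
  have hcode := D.isCode
  -- The same two moves, but the side `O c U x` is now met before `O b U c`, so the triangle has the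
  -- other cyclic order.
  let W1 := [O a] ++ [U y, O x] ++ (U b :: B ++ [O c]) ++ [U x, O y]
    ++ (U d :: C ++ O b :: U c :: E)
  let W2 := [O a, U y] ++ [U b, O x] ++ B ++ [U x, O c] ++ (O y :: U d :: C) ++ [U c, O b] ++ E
  have p1 : (O x :: U x :: O y :: U y :: D.word).Perm W1 := by
    rw [h, List.perm_iff_count]; intro p
    simp only [W1, List.count_append, List.count_cons, List.count_nil]; omega
  have p2 : W1.Perm W2 := by
    rw [List.perm_iff_count]; intro p
    simp only [W1, W2, List.count_append, List.count_cons, List.count_nil]; omega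
  have hr : D.word.Perm (O b :: U b :: O c :: U c :: (O a :: U d :: (B ++ C ++ E))) := by
    rw [h, List.perm_iff_count]; intro p
    simp only [List.count_append, List.count_cons]; omega
  have hc1 : IsCode W1 := hcode.insert_two hxy hf p1
  have hc2 : IsCode W2 := hc1.perm p2
  have e1 : Quotient.mk homotopySetoid D = Quotient.mk homotopySetoid ⟨W1, hc1.1, hc1.2⟩ := by
    apply GaussDiagram.mk_eq_mk
    have := Move.fr2_antiparallel_uo y x [O a] (U b :: B ++ [O c]) (U d :: C ++ O b :: U c :: E)
    simpa [W1, h] using this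
  have e2 : Quotient.mk homotopySetoid ⟨W2, hc2.1, hc2.2⟩ =
      Quotient.mk homotopySetoid ⟨W1, hc1.1, hc1.2⟩ := by
    apply GaussDiagram.mk_eq_mk
    have := Move.fr3_coherent x c b [O a, U y] B (O y :: U d :: C) E
    simpa [W1, W2] using this
  rw [h] at hw
  obtain ⟨w1, w2, hw⟩ := hw
  obtain ⟨k, wB, w3, w4, hw⟩ := walk_append.1 hw
  obtain ⟨k', wC, w5, w6, wE⟩ := walk_append.1 hw
  rw [add_sub_cancel_right] at wB w4 wC w2 wE w6
  have hk : ℓ c = k := w3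
  obtain rfl : k' = t := by linarith
  obtain rfl : k = k' := by linarith
  obtain ⟨ℓ', er, ex, eb, ec, ey, hw'⟩ := exists_levels hlt hcode hxy hf hr hL.2 w2 w3
  obtain ⟨hbd, hcount⟩ := hw' W2 (p1.trans p2)
  refine ⟨⟨W2, hc2.1, hc2.2⟩, ℓ', e1.trans e2.symm, ⟨⟨k, ?_⟩, hbd⟩, hcount⟩
  have ea := er (O a) (by simp)
  have ed := er (U d) (by simp)
  simp only at ea ed
  simp only [W2, walk_append, walk_O_cons, walk_U_cons, List.cons_append, List.nil_append,
    List.append_assoc]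
  refine ⟨by linarith, by linarith, by linarith, by linarith, k, ?_, by linarith, by linarith,
    by linarith, by linarith, k, ?_, by linarith, by linarith, ?_⟩
  · convert wB.congr fun p hp => er p (by simp [hp]) using 1; ring
  · convert wC.congr fun p hp => er p (by simp [hp]) using 1; ring
  · convert wE.congr fun p hp => er p (by simp [hp]) using 1; ring

/-- As long as there are at least two levels, an arrow of the highest level can be removed or
moved to a lower level. -/
theorem exists_levelCount_lt {D : GaussDiagram} {ℓ : ℕ → ℤ} {lo t : ℤ} {a : ℕ} (hlt : lo < t)
    (hL : IsLeveling ℓ lo t D.word) (ha : O a ∈ D.word) (hat : ℓ a = t) :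
    ∃ (D' : GaussDiagram) (ℓ' : ℕ → ℤ),
      Quotient.mk homotopySetoid D = Quotient.mk homotopySetoid D' ∧
      IsLeveling ℓ' lo t D'.word ∧ levelCount ℓ' t D'.word < levelCount ℓ t D.word := by
  obtain ⟨D₁, R, S, hR, hD₁, e₁⟩ := exists_rotate_to_tail D ha
  have hcount : levelCount ℓ t D₁.word = levelCount ℓ t D.word := by
    rw [hR, hD₁]; exact List.perm_append_comm.countP_eq _
  have hL₁ : IsLeveling ℓ lo t D₁.word := by
    rw [hD₁]; rw [hR] at hL; exact hL.rotate
  rw [e₁, ← hcount]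
  rw [List.cons_append] at hD₁
  generalize S ++ R = T at hD₁
  clear hR hcount hL e₁ ha
  obtain ⟨⟨h, hw⟩, hbd⟩ := id hL₁
  -- With the base point at a top tail, the base height is the top level, as `exists_peak` and the
  -- flips require.
  have hht : h = t := by rw [hD₁] at hw; exact hw.1.symm.trans hat
  subst hht
  have peak : ∀ {A B : List Letter} {n : ℕ}, D₁.word = A ++ O n :: B → ℓ n = h →
      ∃ b C, B = U b :: C ∧ ℓ b = h := fun {A B n} e hn => by
    rw [e] at hw hbd
    exact exists_peak hw hbd hn le_rfl
  have hn := D₁.nodup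
  obtain ⟨b, T, rfl, hb⟩ := peak (A := []) hD₁ hat
  -- Fixed point of the peak permutation: an isolated arrow.
  by_cases hab : a = b
  · subst hab
    have hc := D₁.isCode
    rw [hD₁, isCode_cons_cons] at hc
    have hw' := hw
    rw [hD₁] at hw'
    obtain ⟨-, -, hw'⟩ := hw'
    rw [add_sub_cancel_right] at hw'
    refine ⟨⟨T, hc.1.1, hc.1.2⟩, ℓ, Eq.symm (GaussDiagram.mk_eq_mk ?_), ⟨⟨h, hw'⟩, ?_⟩, ?_⟩
    · have := Move.fr1_ou a [] T
      simpa [hD₁] using this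
    · intro p hp
      exact hbd p (by rw [hD₁]; simp [show p ∈ T from hp])
    · rw [hD₁]
      simp [levelCount, hat]
  have hbm : O b ∈ T := by
    have := (D₁.paired b).2 (by simp [hD₁])
    simpa [hD₁, Ne.symm hab] using this
  obtain ⟨B, T', rfl⟩ := List.append_of_mem hbm
  obtain ⟨c, T, rfl, hc⟩ := peak (A := O a :: U b :: B) (n := b) (B := T')
    (by simp [hD₁]) hb
  have hbc : b ≠ c := by
    rintro rfl
    rw [hD₁] at hn
    simp at hn
  -- A 2-cycle: the peaks `O a U b` and `O b U a` bound an FR2 bigon.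
  by_cases hac : a = c
  · subst hac
    have hperm : D₁.word.Perm (O a :: U a :: O b :: U b :: (B ++ T)) := by
      rw [hD₁, List.perm_iff_count]; intro p
      simp only [List.count_append, List.count_cons]; omega
    have hcode := D₁.isCode.perm hperm
    rw [isCode_cons_cons, isCode_cons_cons] at hcode
    have hc' := hcode.1.1
    have hw' := hw
    rw [hD₁] at hw'
    obtain ⟨-, -, hw'⟩ := hw'
    obtain ⟨k, wB, hk, hk', wT⟩ := walk_append.1 hw'
    rw [add_sub_cancel_right] at wB wT
    obtain rfl : k = h := by linarith
    refine ⟨⟨B ++ T, hc'.1, hc'.2⟩, ℓ, Eq.symm (GaussDiagram.mk_eq_mk ?_),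
      ⟨⟨k, walk_append.2 ⟨k, wB, wT⟩⟩, ?_⟩, ?_⟩
    · have := Move.fr2_antiparallel_ou a b [] B T
      simpa [hD₁] using this
    · intro p hp
      exact hbd p (hperm.mem_iff.2 (by simp only [List.mem_cons]; tauto))
    · unfold levelCount
      rw [hperm.countP_eq]
      simp [hat, hb]
      omega
  have hcm : O c ∈ B ∨ O c ∈ T := by
    have := (D₁.paired c).2 (by simp [hD₁])
    simpa [hD₁, Ne.symm hac, Ne.symm hbc] using this
  -- The position of the tail of `c` relative to that of `b` decides the cyclic order of the
  -- triangle.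
  rcases hcm with hcm | hcm
  · obtain ⟨B, C, rfl⟩ := List.append_of_mem hcm
    obtain ⟨d, C', hC, -⟩ := peak (A := O a :: U b :: B) (n := c)
      (B := C ++ O b :: U c :: T) (by simp [hD₁]) hc
    rcases C with _ | ⟨q, C⟩
    · simp at hC
    · simp only [List.cons_append, List.cons.injEq] at hC
      obtain ⟨rfl, rfl⟩ := hC
      exact exists_flip' (a := a) (b := b) (c := c) (d := d) (B := B) (C := C) (E := T) hlt hL₁ hw
        (by rw [hD₁]; simp)
  · obtain ⟨C, E, rfl⟩ := List.append_of_mem hcm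
    obtain ⟨d, E, rfl, -⟩ := peak (A := O a :: U b :: (B ++ O b :: U c :: C)) (n := c)
      (B := E) (by simp [hD₁]) hc
    exact exists_flip hlt hL₁ hw hD₁

/-! ### Descent to a single level. -/

theorem exists_isAlternating_of_level {D : GaussDiagram} {ℓ : ℕ → ℤ} {m : ℤ}
    (hL : IsLeveling ℓ m m D.word) :
    ∃ D' : GaussDiagram, Quotient.mk homotopySetoid D = Quotient.mk homotopySetoid D' ∧
      D'.IsAlternating := by
  by_cases hO : ∃ a, O a ∈ D.word
  · obtain ⟨a, ha⟩ := hO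
    obtain ⟨D', R, S, hR, hD', e⟩ := exists_rotate_to_tail D ha
    have hL' : IsLeveling ℓ m m D'.word := by
      rw [hD']; rw [hR] at hL; exact hL.rotate
    obtain ⟨⟨h, hw⟩, hbd⟩ := hL'
    have hl : ∀ p ∈ D'.word, ℓ p.2 = m := fun p hp => le_antisymm (hbd p hp).2 (hbd p hp).1
    have hh : h = m := by
      have h1 := hl (O a) (by simp [hD'])
      rw [hD', List.cons_append] at hw
      exact hw.1.symm.trans h1
    subst hh
    exact ⟨D', e, alternating_of_walk hl hw⟩
  · refine ⟨D, rfl, 0, ?_⟩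
    have : D.word = [] := by
      rw [List.eq_nil_iff_forall_not_mem]
      intro p hp
      rcases eq_O_or_eq_U p with ⟨n, rfl⟩ | ⟨n, rfl⟩
      exacts [hO ⟨n, hp⟩, hO ⟨n, (D.paired n).2 hp⟩]
    simp [GaussDiagram.ouWord, this]

/-- Induction on the number of levels, with an inner strong induction on the number of endpoints at
the top level. The lower bound `m` stays fixed throughout, so emptying the top level really lowers
`k`. -/
theorem exists_isAlternating_of_isLeveling (m : ℤ) (k : ℕ) :
    ∀ (c : ℕ) (D : GaussDiagram) (ℓ : ℕ → ℤ), IsLeveling ℓ m (m + k) D.word →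
      levelCount ℓ (m + k) D.word = c →
      ∃ D' : GaussDiagram, Quotient.mk homotopySetoid D = Quotient.mk homotopySetoid D' ∧
        D'.IsAlternating := by
  induction k with
  | zero => exact fun _ D ℓ hL _ => exists_isAlternating_of_level (m := m) (by simpa using hL)
  | succ k ih =>
    intro c
    induction c using Nat.strong_induction_on with
    | _ c ihc =>
      intro D ℓ hL hc
      by_cases hO : ∃ a, O a ∈ D.word ∧ ℓ a = m + (k + 1 : ℕ)
      · obtain ⟨a, ha, hat⟩ := hO
        obtain ⟨D', ℓ', e, hL', hlt⟩ :=
          exists_levelCount_lt (by push_cast; linarith) hL ha hat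
        obtain ⟨D'', e', h''⟩ := ihc _ (hc ▸ hlt) D' ℓ' hL' rfl
        exact ⟨D'', e.trans e', h''⟩
      · refine ih _ D ℓ ⟨hL.1, fun p hp => ⟨(hL.2 p hp).1, ?_⟩⟩ rfl
        have h1 := (hL.2 p hp).2
        have h2 : ℓ p.2 ≠ m + (k + 1 : ℕ) := fun h => by
          rcases eq_O_or_eq_U p with ⟨n, rfl⟩ | ⟨n, rfl⟩
          exacts [hO ⟨n, hp, h⟩, hO ⟨n, (D.paired n).2 hp, h⟩]
        push_cast at h1 h2
        omega

theorem exists_isLeveling {ℓ : ℕ → ℤ} {h : ℤ} {w : List Letter} (hw : Walk ℓ h w h) :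
    ∃ (m : ℤ) (k : ℕ), IsLeveling ℓ m (m + k) w := by
  have : ∃ N : ℕ, ∀ p ∈ w, (ℓ p.2).natAbs ≤ N := by
    clear hw
    induction w with
    | nil => exact ⟨0, by simp⟩
    | cons p w ih =>
      obtain ⟨N, hN⟩ := ih
      refine ⟨max N (ℓ p.2).natAbs, fun q hq => ?_⟩
      rcases List.mem_cons.1 hq with rfl | hq
      · exact le_max_right _ _
      · exact (hN q hq).trans (le_max_left _ _)
  obtain ⟨N, hN⟩ := this
  -- All levels lie in `[-N, N]`, an interval of length `2 * N`.
  refine ⟨-N, 2 * N, ⟨h, hw⟩, fun p hp => ?_⟩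
  have := hN p hp
  push_cast
  omega

end FlatKnots

theorem mainTheorem7 (α : FlatKnots.FlatKnot) :
    α.IsAlmostClassical ↔
      ∃ D : FlatKnots.GaussDiagram, D.Represents α ∧ D.IsAlternating := by
  constructor
  · rintro ⟨D, hD, hac⟩
    obtain ⟨ℓ, hw⟩ := hac.exists_walk
    obtain ⟨m, k, hL⟩ := FlatKnots.exists_isLeveling hw
    obtain ⟨D', e, h⟩ := FlatKnots.exists_isAlternating_of_isLeveling m k _ D ℓ hL rfl
    exact ⟨D', e.symm.trans hD, h⟩
  · rintro ⟨D, hD, halt⟩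
    obtain ⟨ℓ, hw⟩ := halt.exists_walk
    exact ⟨D, hD, FlatKnots.GaussDiagram.isAlmostClassical_of_walk hw⟩
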